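/- A graph $(G,V,E)$ is a compact connected CW complex $G$ of dimension one (a single vertex with no edges is also allowed), with set of $0$-cells $V$ and set of $1$-cells $E$; loops and multiple edges are allowed. It is a tree if $G$ is contractible. For $n\ge 0$ let $$\mathrm{Conf}_n^{\mathrm{sink}}(G,V)=\{(x_1,\dots,x_n)\in G^n \mid \text{for all } i\ne j:\ x_i\neq x_j \text{ or } x_i=x_j\in V\},$$ with the subspace topology of $G^n$. Give $G^n$ the product CW structure, whose cells are the products $\sigma_1\times\dots\times\sigma_n$ of (open) cells of $G$, and let $\mathrm{DConf}_n^{\mathrm{sink}}(G,V)\subseteq G^n$ be the subcomplex consisting of all cells $\sigma_1\times\dots\times\sigma_n$ such that $\sigma_i\ne\sigma_j$ whenever $i\neq j$ and $\sigma_i,\sigma_j$ are both $1$-cells. Theorem. For every graph $(G,V,E)$ and every $n\ge 0$, $\mathrm{DConf}_n^{\mathrm{sink}}(G,V)$ is contained in $\mathrm{Conf}_n^{\mathrm{sink}}(G,V)$ and the inclusion is a homotopy equivalence; moreover the CW complex $\mathrm{DConf}_n^{\mathrm{sink}}(G,V)$ has dimension at most $|E|$. If $G$ is a tree, then $\mathrm{DConf}_n^{\mathrm{sink}}(G,V)$,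 with these cells, is a cubical complex: every characteristic map $[-1,1]^k\to \mathrm{DConf}_n^{\mathrm{sink}}(G,V)$ is injective, and any two closed cells that meet do so along a common face, i.e. there is a Euclidean isometry $f:T\to T'$ from a face of one cube onto a face of the other such that a point $x$ of the first cube and a point $y$ of the second have the same image if and only if $x\in T$ and $y=f(x)$. -/

import Mathlib

open Set Metric Topology

namespace SinkConf

/-- A graph: a compact connected (Hausdorff) CW complex `X` all of whose cells have dimension
at most one.  Its vertices are the 0-cells and its edges are the 1-cells. -/
class IsGraph (X : Type*) [TopologicalSpace X] [CWComplex (univ : Set X)] : Prop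
    extends T2Space X, CompactSpace X, ConnectedSpace X where
  isEmpty_cell : ∀ k : ℕ, 1 < k → IsEmpty (RelCWComplex.cell (univ : Set X) k)

/-- The cells of `X`, of all dimensions. -/
abbrev Cell (X : Type*) [TopologicalSpace X] [CWComplex (univ : Set X)] : Type _ :=
  Σ k : ℕ, RelCWComplex.cell (univ : Set X) k

/-- The vertex set `V`, as a subset of `X`: the union of the 0-cells. -/
def vertexSet (X : Type*) [TopologicalSpace X] [CWComplex (univ : Set X)] : Set X :=
  ⋃ v : RelCWComplex.cell (univ : Set X) 0, RelCWComplex.closedCell 0 v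

/-- The sink configuration space: two points with different indices may coincide only at a
vertex. -/
def sinkConf (n : ℕ) (X : Type*) [TopologicalSpace X] [CWComplex (univ : Set X)] :
    Set (Fin n → X) :=
  {x | ∀ i j, i ≠ j → x i ≠ x j ∨ (x i = x j ∧ x i ∈ vertexSet X)}

section Product

variable {X : Type*} [TopologicalSpace X] [CWComplex (univ : Set X)] {n : ℕ}

/-- The coordinates of the cube `[-1, 1] ^ k`, where `k` is the sum of the dimensions of the
cells `σ i`, that belong to the factor `σ i`. -/
def block (σ : Fin n → Cell X) {k : ℕ} (h : ∑ i, (σ i).1 = k) (y : Fin k → ℝ) (i : Fin n) :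
    Fin (σ i).1 → ℝ :=
  fun j ↦ y (finCongr h (finSigmaFinEquiv ⟨i, j⟩))

/-- The inverse of `block`. -/
def unblock (σ : Fin n → Cell X) {k : ℕ} (h : ∑ i, (σ i).1 = k)
    (z : ∀ i, Fin (σ i).1 → ℝ) : Fin k → ℝ :=
  fun j ↦ z (finSigmaFinEquiv.symm (finCongr h.symm j)).1
    (finSigmaFinEquiv.symm (finCongr h.symm j)).2

theorem block_unblock (σ : Fin n → Cell X) {k : ℕ} (h : ∑ i, (σ i).1 = k)
    (z : ∀ i, Fin (σ i).1 → ℝ) : block σ h (unblock σ h z) = z := by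
  subst h
  funext i j
  have key : ∀ p : (i : Fin n) × Fin (σ i).1, p = ⟨i, j⟩ → z p.1 p.2 = z i j := by
    rintro p rfl
    rfl
  exact key _ (by simp)

theorem unblock_block (σ : Fin n → Cell X) {k : ℕ} (h : ∑ i, (σ i).1 = k)
    (y : Fin k → ℝ) : unblock σ h (block σ h y) = y := by
  subst h
  funext j
  simp [block, unblock]

theorem continuous_block (σ : Fin n → Cell X) {k : ℕ} (h : ∑ i, (σ i).1 = k) (i : Fin n) :
    Continuous (fun y : Fin k → ℝ ↦ block σ h y i) := by
  unfold block
  fun_prop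

theorem forall_block (σ : Fin n → Cell X) {k : ℕ} (h : ∑ i, (σ i).1 = k) (y : Fin k → ℝ)
    (p : ℝ → Prop) : (∀ i j, p (block σ h y i j)) ↔ ∀ j, p (y j) := by
  refine ⟨fun H j ↦ ?_, fun H i j ↦ H _⟩
  have := H (finSigmaFinEquiv.symm (finCongr h.symm j)).1
    (finSigmaFinEquiv.symm (finCongr h.symm j)).2
  simpa [block] using this

theorem mem_ball_block (σ : Fin n → Cell X) {k : ℕ} (h : ∑ i, (σ i).1 = k) (y : Fin k → ℝ) :
    y ∈ ball (0 : Fin k → ℝ) 1 ↔ ∀ i, block σ h y i ∈ ball 0 1 := by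
  simp only [mem_ball_zero_iff, pi_norm_lt_iff one_pos]
  exact (forall_block σ h y (fun t ↦ ‖t‖ < 1)).symm

theorem mem_closedBall_block (σ : Fin n → Cell X) {k : ℕ} (h : ∑ i, (σ i).1 = k)
    (y : Fin k → ℝ) :
    y ∈ closedBall (0 : Fin k → ℝ) 1 ↔ ∀ i, block σ h y i ∈ closedBall 0 1 := by
  simp only [mem_closedBall_zero_iff, pi_norm_le_iff_of_nonneg zero_le_one]
  exact (forall_block σ h y (fun t ↦ ‖t‖ ≤ 1)).symm

/-- The characteristic map of the product cell `σ 0 × ⋯ × σ (n - 1)` of `X ^ n`: the product of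
the characteristic maps of its factors. -/
noncomputable def productMap (σ : Fin n → Cell X) {k : ℕ} (h : ∑ i, (σ i).1 = k) :
    PartialEquiv (Fin k → ℝ) (Fin n → X) where
  toFun y i := RelCWComplex.map (C := univ) (σ i).1 (σ i).2 (block σ h y i)
  invFun x := unblock σ h fun i ↦ (RelCWComplex.map (C := univ) (σ i).1 (σ i).2).symm (x i)
  source := ball 0 1
  target := {x | ∀ i, x i ∈ (RelCWComplex.map (C := univ) (σ i).1 (σ i).2).target}
  map_source' y hy i := by
    apply PartialEquiv.map_source
    rw [RelCWComplex.source_eq]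
    exact (mem_ball_block σ h y).1 hy i
  map_target' x hx := by
    rw [mem_ball_block σ h, block_unblock]
    intro i
    rw [← RelCWComplex.source_eq (C := univ) (σ i).1 (σ i).2]
    exact PartialEquiv.map_target _ (hx i)
  left_inv' y hy := by
    rw [← unblock_block σ h y]
    congr 1
    funext i
    rw [unblock_block]
    apply PartialEquiv.left_inv
    rw [RelCWComplex.source_eq]
    exact (mem_ball_block σ h y).1 hy i
  right_inv' x hx := by
    funext i
    simp only [block_unblock]
    exact PartialEquiv.right_inv _ (hx i)

theorem productMap_image_closedBall (σ : Fin n → Cell X) {k : ℕ} (h : ∑ i, (σ i).1 = k) :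
    productMap σ h '' closedBall 0 1 =
      {x | ∀ i, x i ∈ RelCWComplex.closedCell (C := univ) (σ i).1 (σ i).2} := by
  ext x
  constructor
  · rintro ⟨y, hy, rfl⟩ i
    exact ⟨_, (mem_closedBall_block σ h y).1 hy i, rfl⟩
  · intro hx
    choose z hz hzx using hx
    refine ⟨unblock σ h z, ?_, ?_⟩
    · rw [mem_closedBall_block σ h, block_unblock]
      exact hz
    · funext i
      simpa [productMap, block_unblock] using hzx i

theorem productMap_image_ball (σ : Fin n → Cell X) {k : ℕ} (h : ∑ i, (σ i).1 = k) :
    productMap σ h '' ball 0 1 =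
      {x | ∀ i, x i ∈ RelCWComplex.openCell (C := univ) (σ i).1 (σ i).2} := by
  ext x
  constructor
  · rintro ⟨y, hy, rfl⟩ i
    exact ⟨_, (mem_ball_block σ h y).1 hy i, rfl⟩
  · intro hx
    choose z hz hzx using hx
    refine ⟨unblock σ h z, ?_, ?_⟩
    · rw [mem_ball_block σ h, block_unblock]
      exact hz
    · funext i
      simpa [productMap, block_unblock] using hzx i

theorem exists_mem_openCell (x : X) :
    ∃ c : Cell X, x ∈ RelCWComplex.openCell (C := univ) c.1 c.2 := by
  have hx : x ∈ (univ : Set X) := mem_univ x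
  rw [← CWComplex.iUnion_openCell_eq_complex (C := (univ : Set X))] at hx
  simp only [mem_iUnion] at hx
  obtain ⟨k, c, hc⟩ := hx
  exact ⟨⟨k, c⟩, hc⟩

theorem eq_of_mem_openCell {x : X} {c d : Cell X}
    (hc : x ∈ RelCWComplex.openCell (C := univ) c.1 c.2)
    (hd : x ∈ RelCWComplex.openCell (C := univ) d.1 d.2) : c = d := by
  by_contra hne
  exact (Set.disjoint_left.1 (CWComplex.disjoint_openCell_of_ne (C := (univ : Set X))
    (i := c.2) (j := d.2) hne)) hc hd

theorem continuous_unblock (σ : Fin n → Cell X) {k : ℕ} (h : ∑ i, (σ i).1 = k) :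
    Continuous (unblock σ h) := by
  unfold unblock
  fun_prop

/-- A compact Hausdorff CW complex has only finitely many cells. -/
theorem finite_cell [T2Space X] [CompactSpace X] : Finite (Cell X) := by
  -- the centres of the open cells form a closed discrete set
  let p : Cell X → X := fun c ↦ RelCWComplex.map (C := univ) c.1 c.2 0
  have hp : ∀ c, p c ∈ RelCWComplex.openCell (C := univ) c.1 c.2 := fun c ↦
    CWComplex.map_zero_mem_openCell c.1 c.2
  have hinj : Function.Injective p := fun c d hcd ↦
    eq_of_mem_openCell (hp c) (hcd ▸ hp d)
  have hclosed : ∀ S : Set (Cell X), IsClosed (p '' S) := by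
    intro S
    refine CWComplex.closed' (C := (univ : Set X)) _ (subset_univ _) fun k e ↦ ?_
    obtain ⟨I, hI⟩ := CWComplex.cellFrontier_subset_finite_openCell (C := (univ : Set X)) k e
    apply Set.Finite.isClosed
    have hfin : ({⟨k, e⟩} ∪ ⋃ m ∈ Set.Iio k, (Sigma.mk m '' (I m : Set _)) :
        Set (Cell X)).Finite :=
      (Set.finite_singleton _).union
        ((Set.finite_Iio k).biUnion fun m _ ↦ (I m).finite_toSet.image _)
    refine (hfin.image p).subset ?_
    rintro x ⟨⟨c, -, rfl⟩, hx⟩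
    refine ⟨c, ?_, rfl⟩
    have hx' : p c ∈ RelCWComplex.closedCell (C := (univ : Set X)) k e := hx
    rw [← CWComplex.cellFrontier_union_openCell_eq_closedCell] at hx'
    rcases hx' with hx' | hx'
    · have := hI hx'
      simp only [mem_iUnion] at this
      obtain ⟨m, hm, j, hj, hjx⟩ := this
      right
      simp only [mem_iUnion]
      exact ⟨m, hm, j, hj, eq_of_mem_openCell (d := c) (c := ⟨m, j⟩) hjx (hp c)⟩
    · left
      exact eq_of_mem_openCell (d := ⟨k, e⟩) (hp c) hx'
  have hdisc : DiscreteTopology (range p) := by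
    refine discreteTopology_iff_forall_isClosed.2 fun A ↦ ?_
    have : A = Subtype.val ⁻¹' (p '' (p ⁻¹' (Subtype.val '' A))) := by
      ext ⟨x, c, rfl⟩
      constructor
      · intro hx
        exact ⟨c, ⟨_, hx, rfl⟩, rfl⟩
      · rintro ⟨d, ⟨y, hy, hyd⟩, hdc⟩
        have : y = ⟨p c, c, rfl⟩ := Subtype.ext (hyd.trans hdc)
        rwa [← this]
    rw [this]
    exact (hclosed _).preimage continuous_subtype_val
  have hr : IsClosed (range p) := by simpa using hclosed univ
  have : CompactSpace (range p) := isCompact_iff_compactSpace.1 hr.isCompact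
  have : Finite (range p) := finite_of_compact_of_discrete
  exact Finite.of_injective (rangeFactorization p) fun c d h ↦
    hinj (congrArg Subtype.val h)

/-- The product CW structure on `X ^ n`: its `k`-cells are the products `σ 0 × ⋯ × σ (n - 1)` of
cells of `X` whose dimensions add up to `k`. -/
noncomputable instance productCW [T2Space X] [CompactSpace X] :
    CWComplex (univ : Set (Fin n → X)) where
  cell k := {σ : Fin n → Cell X // ∑ i, (σ i).1 = k}
  map _ σ := productMap σ.1 σ.2
  source_eq _ _ := rfl
  continuousOn k σ := by
    refine continuousOn_pi.2 fun i ↦ ?_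
    exact (RelCWComplex.continuousOn (C := (univ : Set X)) (σ.1 i).1 (σ.1 i).2).comp
      (continuous_block σ.1 σ.2 i).continuousOn
      (fun y hy ↦ (mem_closedBall_block σ.1 σ.2 y).1 hy i)
  continuousOn_symm k σ := by
    have key : ContinuousOn
        (fun (x : Fin n → X) i ↦ (RelCWComplex.map (C := univ) (σ.1 i).1 (σ.1 i).2).symm (x i))
        (productMap σ.1 σ.2).target := by
      refine continuousOn_pi.2 fun i ↦ ?_
      exact (RelCWComplex.continuousOn_symm (C := (univ : Set X)) (σ.1 i).1 (σ.1 i).2).comp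
        (continuous_apply (A := fun _ : Fin n ↦ X) i).continuousOn fun x hx ↦ hx i
    exact (continuous_unblock σ.1 σ.2).comp_continuousOn key
  pairwiseDisjoint' := by
    rintro ⟨k, σ, h⟩ - ⟨l, τ, h'⟩ - hne
    refine Set.disjoint_left.2 fun x hx hx' ↦ hne ?_
    simp only [productMap_image_ball] at hx hx'
    have : σ = τ := funext fun i ↦ eq_of_mem_openCell (hx i) (hx' i)
    subst this
    subst h
    subst h'
    rfl
  mapsTo' k σ := by
    obtain ⟨σ, h⟩ := σ
    have hf : Finite (Cell X) := finite_cell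
    have := fun m : ℕ ↦ Fintype.ofFinite {τ : Fin n → Cell X // ∑ i, (τ i).1 = m}
    refine ⟨fun m ↦ Finset.univ, fun y hy ↦ ?_⟩
    simp only [mem_iUnion, Finset.mem_univ, exists_true_left]
    have hyc : ∀ i, block σ h y i ∈ closedBall 0 1 :=
      (mem_closedBall_block σ h y).1 (sphere_subset_closedBall hy)
    have hyb : ∃ i, block σ h y i ∉ ball 0 1 := by
      by_contra! H
      have := (mem_ball_block σ h y).2 H
      rw [mem_ball] at this
      rw [mem_sphere] at hy
      exact this.ne hy
    obtain ⟨i, hi⟩ := hyb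
    have his : block σ h y i ∈ sphere 0 1 := by
      have h1 := hyc i
      rw [mem_closedBall] at h1
      rw [mem_ball, not_lt] at hi
      exact mem_sphere.2 (le_antisymm h1 hi)
    obtain ⟨I, hI⟩ := CWComplex.mapsTo (C := (univ : Set X)) (σ i).1 (σ i).2
    have hm := hI his
    simp only [mem_iUnion] at hm
    obtain ⟨m, hm, j, -, hj⟩ := hm
    refine ⟨∑ l, (Function.update σ i ⟨m, j⟩ l).1, ?_, ⟨Function.update σ i ⟨m, j⟩, rfl⟩, ?_⟩
    · rw [← h]
      refine Finset.sum_lt_sum (fun l _ ↦ ?_) ⟨i, Finset.mem_univ i, by simpa using hm⟩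
      by_cases hl : l = i
      · subst hl
        simpa using hm.le
      · simp [hl]
    · rw [productMap_image_closedBall]
      intro l
      by_cases hl : l = i
      · subst hl
        have hu : Function.update σ l ⟨m, j⟩ l = ⟨m, j⟩ := Function.update_self ..
        dsimp only
        rw [hu]
        exact hj
      · have hu : Function.update σ i ⟨m, j⟩ l = σ l := Function.update_of_ne hl ..
        dsimp only
        rw [hu]
        exact ⟨_, hyc l, rfl⟩
  closed' A _ hA := by
    have hf : Finite (Cell X) := finite_cell
    have : A = ⋃ σ : Fin n → Cell X, A ∩ productMap σ rfl '' closedBall 0 1 := by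
      ext x
      simp only [mem_iUnion, mem_inter_iff, exists_and_left, iff_self_and]
      intro _
      choose σ hσ using fun i ↦ exists_mem_openCell (x i)
      refine ⟨σ, ?_⟩
      rw [productMap_image_closedBall]
      exact fun i ↦ CWComplex.openCell_subset_closedCell _ _ (hσ i)
    rw [this]
    exact isClosed_iUnion_of_finite fun σ ↦ hA _ ⟨σ, rfl⟩
  union' := by
    refine eq_univ_of_forall fun x ↦ ?_
    choose σ hσ using fun i ↦ exists_mem_openCell (x i)
    simp only [mem_iUnion]
    refine ⟨_, ⟨σ, rfl⟩, ?_⟩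
    rw [productMap_image_closedBall]
    exact fun i ↦ CWComplex.openCell_subset_closedCell _ _ (hσ i)

/-- A product cell `σ 0 × ⋯ × σ (n - 1)` belongs to the discrete model if no 1-cell of `X` occurs
twice among its factors. -/
def Admissible (σ : Fin n → Cell X) : Prop :=
  ∀ i j, i ≠ j → (σ i).1 = 1 → (σ j).1 = 1 → σ i ≠ σ j

end Product

/-- The discrete sink configuration space, as a subcomplex of `X ^ n`: the union of the admissible
product cells. -/
noncomputable def discreteSinkConf (n : ℕ) (X : Type*) [TopologicalSpace X]
    [CWComplex (univ : Set X)] [IsGraph X] :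
    CWComplex.Subcomplex (univ : Set (Fin n → X)) :=
  CWComplex.Subcomplex.mk' univ
    (⋃ σ ∈ {σ : Fin n → Cell X | Admissible σ},
      {x | ∀ i, x i ∈ RelCWComplex.openCell (C := univ) (σ i).1 (σ i).2})
    (fun k ↦ {σ : {σ : Fin n → Cell X // ∑ i, (σ i).1 = k} | Admissible σ.1})
    (by
      rintro k ⟨⟨σ, h⟩, hσ⟩ x hx
      have hx' : ∀ i, x i ∈ RelCWComplex.closedCell (C := univ) (σ i).1 (σ i).2 := by
        have : x ∈ productMap σ h '' closedBall 0 1 := hx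
        rwa [productMap_image_closedBall] at this
      choose τ hτ using fun i ↦ exists_mem_openCell (x i)
      have key : ∀ i, (τ i).1 = 1 → τ i = σ i := by
        intro i hi
        have := hx' i
        rw [← CWComplex.cellFrontier_union_openCell_eq_closedCell] at this
        rcases this with hf | ho
        · obtain ⟨I, hI⟩ := CWComplex.cellFrontier_subset_finite_openCell
            (C := (univ : Set X)) (σ i).1 (σ i).2
          have := hI hf
          simp only [mem_iUnion] at this
          obtain ⟨m, hm, j, -, hj⟩ := this
          have hτm := eq_of_mem_openCell (d := ⟨m, j⟩) (hτ i) hj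
          have h2 : m = 1 := by rw [← hi, hτm]
          exact ((IsGraph.isEmpty_cell (X := X) (σ i).1 (h2 ▸ hm)).false (σ i).2).elim
        · exact eq_of_mem_openCell (hτ i) ho
      simp only [mem_iUnion]
      refine ⟨τ, fun i j hij hi hj hc ↦ ?_, hτ⟩
      rw [key i hi, key j hj] at hc
      exact hσ i j hij ((congrArg Sigma.fst (key i hi)).symm.trans hi)
        ((congrArg Sigma.fst (key j hj)).symm.trans hj) hc)
    (by
      ext x
      simp only [mem_iUnion]
      constructor
      · rintro ⟨k, ⟨⟨σ, h⟩, hσ⟩, hx⟩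
        have hx' : x ∈ productMap σ h '' ball 0 1 := hx
        rw [productMap_image_ball] at hx'
        exact ⟨σ, hσ, hx'⟩
      · rintro ⟨σ, hσ, hx⟩
        refine ⟨_, ⟨⟨σ, rfl⟩, hσ⟩, ?_⟩
        change x ∈ productMap σ rfl '' ball 0 1
        rw [productMap_image_ball]
        exact hx)

/-- A (closed, nonempty) face of the cube `[-1, 1] ^ k`: a product of faces of `[-1, 1]`. -/
def IsCubeFace {k : ℕ} (T : Set (Fin k → ℝ)) : Prop :=
  ∃ F : Fin k → Set ℝ, (∀ i, F i = {-1} ∨ F i = {1} ∨ F i = Icc (-1) 1) ∧ T = univ.pi F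

/-- A CW complex, with its characteristic maps `[-1, 1] ^ k → C`, is a cubical complex if every
characteristic map is injective on the whole closed cube and any two closed cells that meet are
glued along an isometry (for the Euclidean distance) between a face of the one cube and a face of
the other. -/
def IsCubical {Y : Type*} [TopologicalSpace Y] (C : Set Y) [CWComplex C] : Prop :=
  (∀ (k : ℕ) (c : RelCWComplex.cell C k), InjOn (RelCWComplex.map k c) (closedBall 0 1)) ∧
  ∀ (k l : ℕ) (c : RelCWComplex.cell C k) (d : RelCWComplex.cell C l),
    (RelCWComplex.closedCell k c ∩ RelCWComplex.closedCell l d).Nonempty →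
    ∃ (T : Set (Fin k → ℝ)) (T' : Set (Fin l → ℝ)) (f : (Fin k → ℝ) → (Fin l → ℝ)),
      IsCubeFace T ∧ IsCubeFace T' ∧ BijOn f T T' ∧
      (∀ x ∈ T, ∀ y ∈ T,
        dist (WithLp.toLp 2 (f x)) (WithLp.toLp 2 (f y)) =
          dist (WithLp.toLp 2 x) (WithLp.toLp 2 y)) ∧
      ∀ x ∈ closedBall (0 : Fin k → ℝ) 1, ∀ y ∈ closedBall (0 : Fin l → ℝ) 1,
        RelCWComplex.map k c x = RelCWComplex.map l d y ↔ x ∈ T ∧ y = f x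

end SinkConf

/-! Homotopy equivalence: let points in the same open edge repel one another. With the edge
parametrized by `[-1, 1]`, a point at `u` pushes a point at `t` away by the distance from `u` to the
end on the side opposite to `t`. Two points at `a < b` end up at least `(b - a) + (1 + a) + (1 - b)
= 2` apart, since every further point can only widen the gap (`pushed_add_two_le`); after clamping
to `[-1, 1]` at most one point is left inside the edge. Linear interpolation from the identity gives
`flow`. Before time 1 it keeps the strict order on each edge, so it stays in the sink configuration
space; it fixes the discrete model, where no point has a companion on its open edge. Hence the
discrete model is a strong deformation retract.

Continuity (`continuousOn_flow`) rests on three facts. A push jumps only at `t = u`, which the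
configuration space excludes inside an edge. A push fades to zero as the pushing point approaches a
vertex. A point at distance `δ` from an end of its edge stays within `(n + 1) * δ` of that end
(`EndControlled`), so points near a vertex remain near it.

Dimension: an admissible product uses each edge at most once.

Trees: collapsing everything outside one open edge `e` gives a map to the circle, which lifts to the
line because the graph is contractible (`exists_unwinding`). The lift rises by a full period along
`e` and is constant on every other edge. So `e` is not a loop, and no other edge contains both of
its ends: distinct closed cells share at most one vertex. Gluing along faces then passes to products
factor by factor (`faceGluing_productMap`). -/

namespace SinkConf

/-! ### Coordinates on the edges of a graph -/

section

variable {X : Type*} [TopologicalSpace X] [CWComplex (univ : Set X)] {n : ℕ}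

/-- The retraction of the real line onto `[-1, 1]`. -/
noncomputable def clamp (t : ℝ) : ℝ := max (-1) (min 1 t)

theorem clamp_mem (t : ℝ) : clamp t ∈ Icc (-1 : ℝ) 1 :=
  ⟨le_max_left _ _, max_le (by norm_num) (min_le_left _ _)⟩

theorem clamp_of_mem {t : ℝ} (ht : t ∈ Icc (-1 : ℝ) 1) : clamp t = t := by
  rw [clamp, min_eq_right ht.2, max_eq_right ht.1]

theorem clamp_mono {a b : ℝ} (h : a ≤ b) : clamp a ≤ clamp b :=
  max_le_max le_rfl (min_le_min le_rfl h)

theorem continuous_clamp : Continuous clamp := by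
  unfold clamp
  fun_prop

theorem neg_one_lt_clamp {t : ℝ} (h : -1 < clamp t) : -1 < t := by
  by_contra! H
  have := clamp_mono H
  rw [clamp_of_mem (t := -1) (by norm_num)] at this
  linarith

theorem clamp_lt_one {t : ℝ} (h : clamp t < 1) : t < 1 := by
  by_contra! H
  have := clamp_mono H
  rw [clamp_of_mem (t := 1) (by norm_num)] at this
  linarith

/-- The characteristic map of an edge, extended to the real line by constants. -/
noncomputable def edgeMap (e : RelCWComplex.cell (univ : Set X) 1) (t : ℝ) : X :=
  RelCWComplex.map (C := univ) 1 e fun _ ↦ clamp t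

/-- The coordinate on an open edge. -/
noncomputable def coord (e : RelCWComplex.cell (univ : Set X) 1) (x : X) : ℝ :=
  (RelCWComplex.map (C := univ) 1 e).symm x 0

variable (e : RelCWComplex.cell (univ : Set X) 1)

theorem mem_closedBall_one {y : Fin 1 → ℝ} : y ∈ closedBall 0 1 ↔ y 0 ∈ Icc (-1 : ℝ) 1 := by
  rw [mem_closedBall_zero_iff, pi_norm_le_iff_of_nonneg zero_le_one]
  simp [abs_le]

theorem mem_ball_one {y : Fin 1 → ℝ} : y ∈ ball 0 1 ↔ y 0 ∈ Ioo (-1 : ℝ) 1 := by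
  rw [mem_ball_zero_iff, pi_norm_lt_iff one_pos]
  simp [abs_lt]

theorem map_one_eq_edgeMap {y : Fin 1 → ℝ} (hy : y ∈ closedBall 0 1) :
    RelCWComplex.map (C := univ) 1 e y = edgeMap e (y 0) := by
  unfold edgeMap
  congr 1
  funext i
  rw [Subsingleton.elim i 0, clamp_of_mem (mem_closedBall_one.1 hy)]

theorem continuous_edgeMap : Continuous (edgeMap e) :=
  (RelCWComplex.continuousOn (C := univ) 1 e).comp_continuous
    (continuous_pi fun _ ↦ continuous_clamp) fun t ↦ mem_closedBall_one.2 (clamp_mem t)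

theorem edgeMap_mem_openCell {t : ℝ} (ht : t ∈ Ioo (-1 : ℝ) 1) :
    edgeMap e t ∈ RelCWComplex.openCell (C := univ) 1 e :=
  ⟨_, mem_ball_one.2 (by rwa [clamp_of_mem (Ioo_subset_Icc_self ht)]), rfl⟩

theorem coord_edgeMap {t : ℝ} (ht : t ∈ Ioo (-1 : ℝ) 1) : coord e (edgeMap e t) = t := by
  unfold coord edgeMap
  rw [PartialEquiv.left_inv, clamp_of_mem (Ioo_subset_Icc_self ht)]
  rw [RelCWComplex.source_eq]
  exact mem_ball_one.2 (by rwa [clamp_of_mem (Ioo_subset_Icc_self ht)])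

variable {e}

theorem exists_edgeMap_of_mem_openCell {x : X}
    (hx : x ∈ RelCWComplex.openCell (C := univ) 1 e) : ∃ t ∈ Ioo (-1 : ℝ) 1, edgeMap e t = x := by
  obtain ⟨y, hy, rfl⟩ := hx
  exact ⟨y 0, mem_ball_one.1 hy, (map_one_eq_edgeMap e (ball_subset_closedBall hy)).symm⟩

theorem coord_mem {x : X} (hx : x ∈ RelCWComplex.openCell (C := univ) 1 e) :
    coord e x ∈ Ioo (-1 : ℝ) 1 := by
  obtain ⟨t, ht, rfl⟩ := exists_edgeMap_of_mem_openCell hx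
  rwa [coord_edgeMap e ht]

theorem edgeMap_coord {x : X} (hx : x ∈ RelCWComplex.openCell (C := univ) 1 e) :
    edgeMap e (coord e x) = x := by
  obtain ⟨t, ht, rfl⟩ := exists_edgeMap_of_mem_openCell hx
  rw [coord_edgeMap e ht]

theorem continuousOn_coord : ContinuousOn (coord e) (RelCWComplex.openCell (C := univ) 1 e) := by
  have h := RelCWComplex.continuousOn_symm (C := univ) 1 e
  have ht : (RelCWComplex.map (C := univ) 1 e).target = RelCWComplex.openCell (C := univ) 1 e := by
    rw [← PartialEquiv.image_source_eq_target, RelCWComplex.source_eq]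
    rfl
  rw [ht] at h
  exact (continuous_apply (0 : Fin 1)).comp_continuousOn h

theorem mem_vertexSet_iff_exists {x : X} :
    x ∈ vertexSet X ↔ ∃ v, x ∈ RelCWComplex.openCell (C := univ) 0 v := by
  simp [vertexSet, RelCWComplex.closedCell_zero_eq_singleton,
    RelCWComplex.openCell_zero_eq_singleton, eq_comm]

theorem notMem_openCell_of_mem_vertexSet {x : X} (hx : x ∈ vertexSet X) :
    x ∉ RelCWComplex.openCell (C := univ) 1 e := by
  intro h
  obtain ⟨v, hv⟩ := mem_vertexSet_iff_exists.1 hx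
  have := congrArg Sigma.fst (eq_of_mem_openCell (c := ⟨0, v⟩) (d := ⟨1, e⟩) hv h)
  simp at this

theorem edge_eq_of_mem {x : X} {f : RelCWComplex.cell (univ : Set X) 1}
    (h : x ∈ RelCWComplex.openCell (C := univ) 1 e)
    (h' : x ∈ RelCWComplex.openCell (C := univ) 1 f) : e = f := by
  have := eq_of_mem_openCell (c := ⟨1, e⟩) (d := ⟨1, f⟩) h h'
  simpa using this

theorem edgeMap_mem_vertexSet {t : ℝ} (ht : t = -1 ∨ t = 1) : edgeMap e t ∈ vertexSet X := by
  obtain ⟨I, hI⟩ := CWComplex.cellFrontier_subset_finite_openCell (C := (univ : Set X)) 1 e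
  have hs : edgeMap e t ∈ RelCWComplex.cellFrontier (C := univ) 1 e := by
    refine ⟨_, ?_, rfl⟩
    rw [clamp_of_mem (by rcases ht with rfl | rfl <;> norm_num), mem_sphere_zero_iff_norm,
      pi_norm_const]
    rcases ht with rfl | rfl <;> simp
  have := hI hs
  simp only [mem_iUnion] at this
  obtain ⟨m, hm, j, -, hj⟩ := this
  obtain rfl : m = 0 := by omega
  exact mem_vertexSet_iff_exists.2 ⟨j, hj⟩

theorem eq_or_eq_of_edgeMap_notMem {t : ℝ} (ht : t ∈ Icc (-1 : ℝ) 1)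
    (h : edgeMap e t ∉ RelCWComplex.openCell (C := univ) 1 e) : t = -1 ∨ t = 1 := by
  by_contra! H
  exact h (edgeMap_mem_openCell e ⟨ht.1.lt_of_ne H.1.symm, ht.2.lt_of_ne H.2⟩)

theorem mem_openCell_of_edgeMap_mem {t : ℝ} (ht : t ∈ Icc (-1 : ℝ) 1)
    {f : RelCWComplex.cell (univ : Set X) 1}
    (h : edgeMap e t ∈ RelCWComplex.openCell (C := univ) 1 f) : e = f ∧ t ∈ Ioo (-1 : ℝ) 1 := by
  have hne : ¬(t = -1 ∨ t = 1) := fun H ↦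
    notMem_openCell_of_mem_vertexSet (edgeMap_mem_vertexSet H) h
  push Not at hne
  have ht' : t ∈ Ioo (-1 : ℝ) 1 := ⟨ht.1.lt_of_ne hne.1.symm, ht.2.lt_of_ne hne.2⟩
  exact ⟨edge_eq_of_mem (edgeMap_mem_openCell e ht') h, ht'⟩

variable [IsGraph X]

theorem cell_dim_le_one (c : Cell X) : c.1 ≤ 1 := by
  by_contra! h
  exact (IsGraph.isEmpty_cell (X := X) c.1 h).false c.2

theorem mem_vertexSet_or (x : X) :
    x ∈ vertexSet X ∨ ∃ e, x ∈ RelCWComplex.openCell (C := univ) 1 e := by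
  obtain ⟨⟨k, c⟩, hc⟩ := exists_mem_openCell x
  have hk : k ≤ 1 := cell_dim_le_one ⟨k, c⟩
  interval_cases k
  · exact .inl (mem_vertexSet_iff_exists.2 ⟨c, hc⟩)
  · exact .inr ⟨c, hc⟩

instance finite_edge : Finite (RelCWComplex.cell (univ : Set X) 1) := by
  have : Finite (Cell X) := finite_cell
  exact Finite.of_injective (fun e ↦ (⟨1, e⟩ : Cell X)) sigma_mk_injective

variable (e) in
-- In dimension one the frontier of any cell consists of vertices, so the complement is the union of
-- the finitely many other closed cells.
theorem isOpen_edge : IsOpen (RelCWComplex.openCell (C := (univ : Set X)) 1 e) := by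
  have : Finite (Cell X) := finite_cell
  have h : (RelCWComplex.openCell (C := (univ : Set X)) 1 e)ᶜ =
      ⋃ c ∈ {c : Cell X | c ≠ ⟨1, e⟩}, RelCWComplex.closedCell (C := univ) c.1 c.2 := by
    ext x
    simp only [mem_compl_iff, mem_iUnion, mem_ofPred_eq, exists_prop]
    constructor
    · intro hx
      obtain ⟨c, hc⟩ := exists_mem_openCell x
      refine ⟨c, ?_, CWComplex.openCell_subset_closedCell _ _ hc⟩
      rintro rfl
      exact hx hc
    · rintro ⟨⟨k, c⟩, hne, hx⟩ hxe
      rw [← CWComplex.cellFrontier_union_openCell_eq_closedCell] at hx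
      rcases hx with hx | hx
      · obtain ⟨I, hI⟩ := CWComplex.cellFrontier_subset_finite_openCell (C := (univ : Set X)) k c
        have := hI hx
        simp only [mem_iUnion] at this
        obtain ⟨m, hm, j, -, hj⟩ := this
        have h1 := congrArg Sigma.fst (eq_of_mem_openCell (c := ⟨m, j⟩) (d := ⟨1, e⟩) hj hxe)
        have h2 := cell_dim_le_one ⟨k, c⟩
        dsimp only at h1 h2
        omega
      · exact hne (eq_of_mem_openCell hx hxe)
  rw [← isClosed_compl_iff, h]
  exact (toFinite _).isClosed_biUnion fun c _ ↦ RelCWComplex.isClosed_closedCell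

theorem continuousAt_coord {x : X} (hx : x ∈ RelCWComplex.openCell (C := univ) 1 e) :
    ContinuousAt (coord e) x :=
  continuousOn_coord.continuousAt ((isOpen_edge e).mem_nhds hx)

end

/-! ### Repulsion on a single edge -/

section

variable {X : Type*} [TopologicalSpace X] [CWComplex (univ : Set X)] {n : ℕ}
  {e : RelCWComplex.cell (univ : Set X) 1}

/-- The displacement of a point with coordinate `t` of an edge caused by another point, with
coordinate `u`, of the same edge: it is pushed away, by the distance from the other point to the
end of the edge that lies beyond it. -/
noncomputable def pushCoord (t u : ℝ) : ℝ := if u < t then 1 + u else if t < u then u - 1 else 0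

theorem pushCoord_self (t : ℝ) : pushCoord t t = 0 := by simp [pushCoord]

/-- As `t` passes `u` the value steps through `u - 1`, `0`, `1 + u`, which increase because `u` is
interior. -/
theorem pushCoord_mono {s t u : ℝ} (hu : u ∈ Ioo (-1 : ℝ) 1) (h : s ≤ t) :
    pushCoord s u ≤ pushCoord t u := by
  obtain ⟨h1, h2⟩ := hu
  unfold pushCoord
  split_ifs <;> linarith

/-- Only a point between the end `-1` and `t` pushes towards `1`, and its push `1 + u` is then less
than `1 + t`. -/
theorem pushCoord_le {t u : ℝ} (ht : t ∈ Ioo (-1 : ℝ) 1) (hu : u ∈ Ioo (-1 : ℝ) 1) :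
    pushCoord t u ≤ 1 + t := by
  obtain ⟨h1, h2⟩ := hu
  obtain ⟨h3, h4⟩ := ht
  unfold pushCoord
  split_ifs <;> linarith

theorem le_pushCoord {t u : ℝ} (ht : t ∈ Ioo (-1 : ℝ) 1) (hu : u ∈ Ioo (-1 : ℝ) 1) :
    -(1 - t) ≤ pushCoord t u := by
  obtain ⟨h1, h2⟩ := hu
  obtain ⟨h3, h4⟩ := ht
  unfold pushCoord
  split_ifs <;> linarith

open Classical in
/-- The displacement of the point with coordinate `t` of the edge `e` caused by the point `y`. -/
noncomputable def push (e : RelCWComplex.cell (univ : Set X) 1) (t : ℝ) (y : X) : ℝ :=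
  if y ∈ RelCWComplex.openCell (C := univ) 1 e then pushCoord t (coord e y) else 0

theorem push_of_mem {t : ℝ} {y : X} (hy : y ∈ RelCWComplex.openCell (C := univ) 1 e) :
    push e t y = pushCoord t (coord e y) := if_pos hy

theorem push_of_notMem {t : ℝ} {y : X} (hy : y ∉ RelCWComplex.openCell (C := univ) 1 e) :
    push e t y = 0 := if_neg hy

theorem push_mono {s t : ℝ} (y : X) (h : s ≤ t) : push e s y ≤ push e t y := by
  by_cases hy : y ∈ RelCWComplex.openCell (C := univ) 1 e
  · rw [push_of_mem hy, push_of_mem hy]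
    exact pushCoord_mono (coord_mem hy) h
  · rw [push_of_notMem hy, push_of_notMem hy]

theorem push_le {t : ℝ} (ht : t ∈ Ioo (-1 : ℝ) 1) (y : X) : push e t y ≤ 1 + t := by
  by_cases hy : y ∈ RelCWComplex.openCell (C := univ) 1 e
  · rw [push_of_mem hy]
    exact pushCoord_le ht (coord_mem hy)
  · rw [push_of_notMem hy]
    linarith [ht.1]

theorem le_push {t : ℝ} (ht : t ∈ Ioo (-1 : ℝ) 1) (y : X) : -(1 - t) ≤ push e t y := by
  by_cases hy : y ∈ RelCWComplex.openCell (C := univ) 1 e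
  · rw [push_of_mem hy]
    exact le_pushCoord ht (coord_mem hy)
  · rw [push_of_notMem hy]
    linarith [ht.2]

/-- The coordinate on the edge `e`, not yet clamped, to which the configuration `x` moves the point
with coordinate `t`. -/
noncomputable def pushed (e : RelCWComplex.cell (univ : Set X) 1) (x : Fin n → X) (t : ℝ) : ℝ :=
  t + ∑ l, push e t (x l)

/-- Monotonicity of `push` lets all summands except those of `i` and `j` be dropped; these two
contribute `1 + coord e (x i)` and `1 - coord e (x j)`, which complete the original gap to the
length 2 of the edge. -/
theorem pushed_add_two_le {x : Fin n → X} {i j : Fin n}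
    (hi : x i ∈ RelCWComplex.openCell (C := univ) 1 e)
    (hj : x j ∈ RelCWComplex.openCell (C := univ) 1 e) (h : coord e (x i) < coord e (x j)) :
    pushed e x (coord e (x i)) + 2 ≤ pushed e x (coord e (x j)) := by
  have hne : i ≠ j := by
    rintro rfl
    exact h.false
  have hs := Finset.sum_le_sum_of_subset_of_nonneg (Finset.subset_univ {i, j})
    (f := fun l ↦ push e (coord e (x j)) (x l) - push e (coord e (x i)) (x l))
    fun l _ _ ↦ sub_nonneg.2 (push_mono _ h.le)
  rw [Finset.sum_pair hne, Finset.sum_sub_distrib, push_of_mem hi, push_of_mem hj,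
    push_of_mem hi, push_of_mem hj, pushCoord_self, pushCoord_self] at hs
  have h1 : pushCoord (coord e (x j)) (coord e (x i)) = 1 + coord e (x i) := if_pos h
  have h2 : pushCoord (coord e (x i)) (coord e (x j)) = coord e (x j) - 1 := by
    rw [pushCoord, if_neg h.not_gt, if_pos h]
  rw [h1, h2] at hs
  unfold pushed
  linarith

/-- Both distances of `u` from the ends of `[-1, 1]` are at most `c` times those of `t`. -/
def EndControlled (c t u : ℝ) : Prop :=
  u ∈ Icc (-1 : ℝ) 1 ∧ 1 + u ≤ c * (1 + t) ∧ 1 - u ≤ c * (1 - t)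

theorem endControlled_self {c t : ℝ} (hc : 1 ≤ c) (ht : t ∈ Icc (-1 : ℝ) 1) :
    EndControlled c t t :=
  ⟨ht, le_mul_of_one_le_left (by linarith [ht.1]) hc, le_mul_of_one_le_left (by linarith [ht.2]) hc⟩

/-- The factor is `n + 1`: the original distance to the end, plus `n` pushes, each at most that
distance. -/
theorem endControlled_clamp_pushed {t : ℝ} (ht : t ∈ Ioo (-1 : ℝ) 1) (x : Fin n → X) :
    EndControlled (n + 1) t (clamp (pushed e x t)) := by
  have h1 : ∑ l, push e t (x l) ≤ n * (1 + t) := by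
    refine (Finset.sum_le_sum fun l _ ↦ push_le ht (x l)).trans_eq ?_
    rw [Finset.sum_const, Finset.card_univ, Fintype.card_fin, nsmul_eq_mul]
  have h2 : n * -(1 - t) ≤ ∑ l, push e t (x l) := by
    refine Eq.trans_le ?_ (Finset.sum_le_sum fun l _ ↦ le_push ht (x l))
    rw [Finset.sum_const, Finset.card_univ, Fintype.card_fin, nsmul_eq_mul]
  have h3 : 0 ≤ (n : ℝ) * (1 + t) := mul_nonneg n.cast_nonneg (by linarith [ht.1])
  have h4 : 0 ≤ (n : ℝ) * (1 - t) := mul_nonneg n.cast_nonneg (by linarith [ht.2])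
  refine ⟨clamp_mem _, ?_, ?_⟩
  · have : clamp (pushed e x t) ≤ (n + 1) * (1 + t) - 1 := by
      refine max_le (by linarith [ht.1]) ((min_le_right _ _).trans ?_)
      unfold pushed
      linarith
    linarith
  · have : 1 - (n + 1) * (1 - t) ≤ clamp (pushed e x t) := by
      refine le_max_of_le_right (le_min (by linarith [ht.2]) ?_)
      unfold pushed
      linarith
    linarith

theorem EndControlled.convexComb {c t u v s : ℝ} (hs : s ∈ Icc (0 : ℝ) 1)
    (hu : EndControlled c t u) (hv : EndControlled c t v) :
    EndControlled c t ((1 - s) * u + s * v) := by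
  obtain ⟨⟨u1, u2⟩, u3, u4⟩ := hu
  obtain ⟨⟨v1, v2⟩, v3, v4⟩ := hv
  have h0 : 0 ≤ 1 - s := by linarith [hs.2]
  refine ⟨⟨?_, ?_⟩, ?_, ?_⟩
  · linarith [mul_le_mul_of_nonneg_left u1 h0, mul_le_mul_of_nonneg_left v1 hs.1]
  · linarith [mul_le_mul_of_nonneg_left u2 h0, mul_le_mul_of_nonneg_left v2 hs.1]
  · linarith [mul_le_mul_of_nonneg_left u3 h0, mul_le_mul_of_nonneg_left v3 hs.1]
  · linarith [mul_le_mul_of_nonneg_left u4 h0, mul_le_mul_of_nonneg_left v4 hs.1]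

/-- The coordinate on the edge `e`, at time `s`, of the point that starts with coordinate `t`. -/
noncomputable def flowCoord (e : RelCWComplex.cell (univ : Set X) 1) (s : ℝ) (x : Fin n → X)
    (t : ℝ) : ℝ :=
  (1 - s) * t + s * clamp (pushed e x t)

theorem endControlled_flowCoord {s t : ℝ} (hs : s ∈ Icc (0 : ℝ) 1) (ht : t ∈ Ioo (-1 : ℝ) 1)
    (x : Fin n → X) : EndControlled (n + 1) t (flowCoord e s x t) :=
  (endControlled_self (by simp) (Ioo_subset_Icc_self ht)).convexComb hs
    (endControlled_clamp_pushed ht x)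

/-! ### The repelling flow and the discrete model -/

open Classical in
/-- The flow that makes points in the interior of the same edge repel each other, until at time `1`
at most one is left there. -/
noncomputable def flow (s : ℝ) (x : Fin n → X) (i : Fin n) : X :=
  if h : ∃ e, x i ∈ RelCWComplex.openCell (C := univ) 1 e then
    edgeMap h.choose (flowCoord h.choose s x (coord h.choose (x i)))
  else x i

theorem flow_of_mem {s : ℝ} {x : Fin n → X} {i : Fin n}
    (h : x i ∈ RelCWComplex.openCell (C := univ) 1 e) :
    flow s x i = edgeMap e (flowCoord e s x (coord e (x i))) := by
  have hex : ∃ e, x i ∈ RelCWComplex.openCell (C := univ) 1 e := ⟨e, h⟩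
  have : hex.choose = e := edge_eq_of_mem hex.choose_spec h
  rw [flow, dif_pos hex, this]

theorem flow_of_mem_vertexSet {s : ℝ} {x : Fin n → X} {i : Fin n} (h : x i ∈ vertexSet X) :
    flow s x i = x i :=
  dif_neg fun ⟨_, he⟩ ↦ notMem_openCell_of_mem_vertexSet h he

theorem mem_of_flow_mem [IsGraph X] {s : ℝ} (hs : s ∈ Icc (0 : ℝ) 1) {x : Fin n → X} {i : Fin n}
    (h : flow s x i ∈ RelCWComplex.openCell (C := univ) 1 e) :
    x i ∈ RelCWComplex.openCell (C := univ) 1 e ∧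
      flowCoord e s x (coord e (x i)) ∈ Ioo (-1 : ℝ) 1 := by
  rcases mem_vertexSet_or (x i) with hv | ⟨f, hf⟩
  · rw [flow_of_mem_vertexSet hv] at h
    exact (notMem_openCell_of_mem_vertexSet hv h).elim
  · rw [flow_of_mem hf] at h
    obtain ⟨rfl, h'⟩ := mem_openCell_of_edgeMap_mem
      (endControlled_flowCoord hs (coord_mem hf) x).1 h
    exact ⟨hf, h'⟩

theorem flow_zero [IsGraph X] (x : Fin n → X) : flow 0 x = x := by
  funext i
  rcases mem_vertexSet_or (x i) with hv | ⟨f, hf⟩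
  · exact flow_of_mem_vertexSet hv
  · rw [flow_of_mem hf]
    simpa [flowCoord] using edgeMap_coord hf

/-- Before time 1 the unmoved part of the interpolation is strictly increasing and the clamped part
is monotone. At time 1 a gap of 2 cannot fit inside the open interval, so the interiority
assumptions rule that time out. The two conclusions serve respectively `flow_one_mem` and
`flow_mem_sinkConf`. -/
theorem flowCoord_lt {s : ℝ} (hs : s ∈ Icc (0 : ℝ) 1) {x : Fin n → X} {i j : Fin n}
    (hi : x i ∈ RelCWComplex.openCell (C := univ) 1 e)
    (hj : x j ∈ RelCWComplex.openCell (C := univ) 1 e) (h : coord e (x i) < coord e (x j))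
    (hi' : flowCoord e s x (coord e (x i)) ∈ Ioo (-1 : ℝ) 1)
    (hj' : flowCoord e s x (coord e (x j)) ∈ Ioo (-1 : ℝ) 1) :
    s < 1 ∧ flowCoord e s x (coord e (x i)) < flowCoord e s x (coord e (x j)) := by
  have h2 := pushed_add_two_le hi hj h
  rcases hs.2.lt_or_eq with hs1 | rfl
  · refine ⟨hs1, add_lt_add_of_lt_of_le (mul_lt_mul_of_pos_left h (by linarith)) ?_⟩
    exact mul_le_mul_of_nonneg_left (clamp_mono (by linarith)) hs.1
  · simp only [flowCoord, sub_self, zero_mul, one_mul, zero_add] at hi' hj'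
    linarith [neg_one_lt_clamp hi'.1, clamp_lt_one hj'.2]

theorem coord_ne {x : Fin n → X} (hx : x ∈ sinkConf n X) {i j : Fin n} (hij : i ≠ j)
    (hi : x i ∈ RelCWComplex.openCell (C := univ) 1 e)
    (hj : x j ∈ RelCWComplex.openCell (C := univ) 1 e) : coord e (x i) ≠ coord e (x j) := by
  intro h
  have hxx : x i = x j := by rw [← edgeMap_coord hi, ← edgeMap_coord hj, h]
  rcases hx i j hij with h | ⟨-, hv⟩
  · exact h hxx
  · exact notMem_openCell_of_mem_vertexSet hv hi

theorem flow_mem_sinkConf [IsGraph X] {s : ℝ} (hs : s ∈ Icc (0 : ℝ) 1) {x : Fin n → X}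
    (hx : x ∈ sinkConf n X) : flow s x ∈ sinkConf n X := by
  intro i j hij
  by_contra! H
  obtain ⟨hxx, H⟩ := H
  obtain ⟨e, hi⟩ := (mem_vertexSet_or _).resolve_left (H hxx)
  have hj := hi
  rw [hxx] at hj
  obtain ⟨hi1, hi2⟩ := mem_of_flow_mem hs hi
  obtain ⟨hj1, hj2⟩ := mem_of_flow_mem hs hj
  rw [flow_of_mem hi1, flow_of_mem hj1] at hxx
  have heq := congrArg (coord e) hxx
  rw [coord_edgeMap e hi2, coord_edgeMap e hj2] at heq
  rcases (coord_ne hx hij hi1 hj1).lt_or_gt with h | h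
  · exact (flowCoord_lt hs hi1 hj1 h hi2 hj2).2.ne heq
  · exact (flowCoord_lt hs hj1 hi1 h hj2 hi2).2.ne heq.symm

theorem mem_discreteSinkConf_iff [IsGraph X] {x : Fin n → X} :
    x ∈ (discreteSinkConf n X : Set (Fin n → X)) ↔ ∀ i j, i ≠ j → ∀ e,
      x i ∈ RelCWComplex.openCell (C := univ) 1 e → x j ∉ RelCWComplex.openCell (C := univ) 1 e := by
  have h : x ∈ (discreteSinkConf n X : Set (Fin n → X)) ↔ ∃ σ : Fin n → Cell X, Admissible σ ∧
      ∀ i, x i ∈ RelCWComplex.openCell (C := univ) (σ i).1 (σ i).2 := by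
    change x ∈ (⋃ σ ∈ {σ : Fin n → Cell X | Admissible σ},
      {x | ∀ i, x i ∈ RelCWComplex.openCell (C := univ) (σ i).1 (σ i).2}) ↔ _
    simp
  rw [h]
  constructor
  · rintro ⟨σ, hσ, hx⟩ i j hij e hi hj
    have h1 := eq_of_mem_openCell (d := ⟨1, e⟩) (hx i) hi
    have h2 := eq_of_mem_openCell (d := ⟨1, e⟩) (hx j) hj
    exact hσ i j hij (congrArg Sigma.fst h1) (congrArg Sigma.fst h2) (h1.trans h2.symm)
  · intro H
    choose σ hσ using fun i ↦ exists_mem_openCell (x i)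
    refine ⟨σ, fun i j hij hi _ hc ↦ ?_, hσ⟩
    have hj := hσ j
    rw [← hc] at hj
    have hi' := hσ i
    generalize σ i = c at hi hi' hj
    obtain ⟨k, c⟩ := c
    obtain rfl : k = 1 := hi
    exact H i j hij c hi' hj

theorem discreteSinkConf_subset [IsGraph X] :
    (discreteSinkConf n X : Set (Fin n → X)) ⊆ sinkConf n X := by
  intro x hx i j hij
  by_contra! H
  obtain ⟨hxx, H⟩ := H
  obtain ⟨e, hi⟩ := (mem_vertexSet_or _).resolve_left (H hxx)
  exact mem_discreteSinkConf_iff.1 hx i j hij e hi (hxx ▸ hi)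

theorem flow_one_mem [IsGraph X] {x : Fin n → X} (hx : x ∈ sinkConf n X) :
    flow 1 x ∈ (discreteSinkConf n X : Set (Fin n → X)) := by
  refine mem_discreteSinkConf_iff.2 fun i j hij e hi hj ↦ ?_
  have hs : (1 : ℝ) ∈ Icc (0 : ℝ) 1 := by norm_num
  obtain ⟨hi1, hi2⟩ := mem_of_flow_mem hs hi
  obtain ⟨hj1, hj2⟩ := mem_of_flow_mem hs hj
  rcases (coord_ne hx hij hi1 hj1).lt_or_gt with h | h
  · exact (flowCoord_lt hs hi1 hj1 h hi2 hj2).1.false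
  · exact (flowCoord_lt hs hj1 hi1 h hj2 hi2).1.false

theorem flow_of_mem_discreteSinkConf [IsGraph X] (s : ℝ) {x : Fin n → X}
    (hx : x ∈ (discreteSinkConf n X : Set (Fin n → X))) : flow s x = x := by
  funext i
  rcases mem_vertexSet_or (x i) with hv | ⟨e, he⟩
  · exact flow_of_mem_vertexSet hv
  · have h0 : ∑ l, push e (coord e (x i)) (x l) = 0 := by
      refine Finset.sum_eq_zero fun l _ ↦ ?_
      by_cases hl : i = l
      · rw [← hl, push_of_mem he, pushCoord_self]
      · exact push_of_notMem (mem_discreteSinkConf_iff.1 hx i l hl e he)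
    rw [flow_of_mem he, flowCoord, pushed, h0, add_zero,
      clamp_of_mem (Ioo_subset_Icc_self (coord_mem he)), ← add_mul, sub_add_cancel, one_mul,
      edgeMap_coord he]

/-! ### Continuity of the flow -/

theorem eventually_edgeMap_mem [IsGraph X] (c : ℝ) {v : X} {U : Set X} (hU : U ∈ 𝓝 v)
    (hv : v ∉ RelCWComplex.openCell (C := univ) 1 e) :
    ∀ᶠ y in 𝓝 v, y ∈ RelCWComplex.openCell (C := univ) 1 e →
      ∀ u, EndControlled c (coord e y) u → edgeMap e u ∈ U := by
  -- The bad pairs: `u` is controlled by `t` but lands outside the interior of `U`. They form a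
  -- compact set, so the bad starting points are closed; `v` is not one of them, because at an end
  -- of the edge the control forces `u = t`.
  let P : Set (ℝ × ℝ) := (Icc (-1) 1 ×ˢ Icc (-1) 1) ∩
    ({p | 1 + p.2 ≤ c * (1 + p.1)} ∩ {p | 1 - p.2 ≤ c * (1 - p.1)} ∩
      {p | edgeMap e p.2 ∈ (interior U)ᶜ})
  have hP : IsCompact P := by
    refine (isCompact_Icc.prod isCompact_Icc).inter_right (IsClosed.inter (IsClosed.inter ?_ ?_) ?_)
    · exact isClosed_le (by fun_prop) (by fun_prop)
    · exact isClosed_le (by fun_prop) (by fun_prop)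
    · exact isOpen_interior.isClosed_compl.preimage ((continuous_edgeMap e).comp continuous_snd)
  have hK : IsClosed (edgeMap e '' (Prod.fst '' P)) :=
    ((hP.image continuous_fst).image (continuous_edgeMap e)).isClosed
  have hvK : v ∉ edgeMap e '' (Prod.fst '' P) := by
    rintro ⟨_, ⟨⟨t, u⟩, ⟨⟨ht, hu⟩, ⟨h1, h2⟩, h3⟩, rfl⟩, rfl⟩
    simp only [mem_ofPred_eq] at ht hu h1 h2 h3 hv hU
    refine h3 ?_
    have htu : u = t := by
      rcases eq_or_eq_of_edgeMap_notMem ht hv with rfl | rfl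
      · linarith [hu.1]
      · linarith [hu.2]
    rw [htu]
    exact mem_interior_iff_mem_nhds.2 hU
  filter_upwards [hK.isOpen_compl.mem_nhds hvK] with y hy hye u ⟨hu, h1, h2⟩
  by_contra H
  exact hy ⟨coord e y, ⟨(coord e y, u), ⟨⟨Ioo_subset_Icc_self (coord_mem hye), hu⟩, ⟨h1, h2⟩,
    fun h ↦ H (interior_subset h)⟩, rfl⟩, edgeMap_coord hye⟩

/-- The middle segment `[-r, r]` of the edge is compact and misses `y`, so nearby points of the edge
lie close to its ends. -/
theorem eventually_lt_abs_coord [IsGraph X] {y : X}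
    (hy : y ∉ RelCWComplex.openCell (C := univ) 1 e) {r : ℝ} (hr : r < 1) :
    ∀ᶠ z in 𝓝 y, z ∈ RelCWComplex.openCell (C := univ) 1 e → r < |coord e z| := by
  have hK : IsClosed (edgeMap e '' (Icc (-r) r)) :=
    (isCompact_Icc.image (continuous_edgeMap e)).isClosed
  have hyK : y ∉ edgeMap e '' (Icc (-r) r) := by
    rintro ⟨t, ht, rfl⟩
    exact hy (edgeMap_mem_openCell e ⟨by linarith [ht.1], by linarith [ht.2]⟩)
  filter_upwards [hK.isOpen_compl.mem_nhds hyK] with z hz hze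
  by_contra! H
  exact hz ⟨coord e z, abs_le.1 H, edgeMap_coord hze⟩

theorem continuousAt_push [IsGraph X] {t : ℝ} (ht : t ∈ Ioo (-1 : ℝ) 1) {y : X}
    (hy : y ≠ edgeMap e t) : ContinuousAt (fun p : ℝ × X ↦ push e p.1 p.2) (t, y) := by
  by_cases hye : y ∈ RelCWComplex.openCell (C := univ) 1 e
  · have hc : ContinuousAt (fun p : ℝ × X ↦ coord e p.2) (t, y) :=
      (continuousAt_coord hye).comp' continuousAt_snd
    have hmem : ∀ᶠ p : ℝ × X in 𝓝 (t, y), p.2 ∈ RelCWComplex.openCell (C := univ) 1 e :=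
      continuousAt_snd.eventually ((isOpen_edge e).mem_nhds hye)
    have hne : coord e y ≠ t := by
      rintro rfl
      exact hy (edgeMap_coord hye).symm
    rcases hne.lt_or_gt with h | h
    · refine (hc.const_add 1).congr ?_
      filter_upwards [hmem, hc.eventually_lt continuousAt_fst h] with p hp hlt
      rw [push_of_mem hp, pushCoord, if_pos hlt]
    · refine ContinuousAt.congr (f := fun p : ℝ × X ↦ coord e p.2 - 1)
        (hc.sub continuousAt_const) ?_
      filter_upwards [hmem, continuousAt_fst.eventually_lt hc h] with p hp hlt
      rw [push_of_mem hp, pushCoord, if_neg hlt.not_gt, if_pos hlt]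
  · rw [ContinuousAt, push_of_notMem hye, Metric.tendsto_nhds]
    intro ε hε
    have habs : |t| < 1 := abs_lt.2 ht
    have h1 : ∀ᶠ p : ℝ × X in 𝓝 (t, y), |p.1| < (1 + |t|) / 2 :=
      (continuous_abs.continuousAt.comp' continuousAt_fst).eventually_lt continuousAt_const
        (by linarith)
    have h2 := (continuousAt_snd (p := ((t, y) : ℝ × X))).eventually
      -- The bound `1 - ε` makes the push smaller than `ε`; the bound `(1 + |t|) / 2` keeps the
      -- pushing point beyond every coordinate near `t`, which settles the branch of `pushCoord`.
      (eventually_lt_abs_coord hye (r := max (1 - ε) ((1 + |t|) / 2))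
        (max_lt (by linarith) (by linarith)))
    filter_upwards [h1, h2] with p hp1 hp2
    rw [Real.dist_0_eq_abs]
    by_cases hpe : p.2 ∈ RelCWComplex.openCell (C := univ) 1 e
    · obtain ⟨h3, h4⟩ := max_lt_iff.1 (hp2 hpe)
      obtain ⟨h5, h6⟩ := coord_mem hpe
      obtain ⟨h7, h8⟩ := abs_lt.1 hp1
      rw [push_of_mem hpe, pushCoord]
      rcases lt_abs.1 h4 with h | h
      · rw [abs_of_pos (by linarith [abs_nonneg t])] at h3
        rw [if_neg (by linarith), if_pos (by linarith), abs_lt]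
        constructor <;> linarith
      · rw [abs_of_neg (by linarith [abs_nonneg t])] at h3
        rw [if_pos (by linarith), abs_lt]
        constructor <;> linarith
    · simpa [push_of_notMem hpe] using hε

theorem continuousOn_flow [IsGraph X] :
    ContinuousOn (fun p : ℝ × (Fin n → X) ↦ flow p.1 p.2) (Icc 0 1 ×ˢ sinkConf n X) := by
  rintro ⟨s, x⟩ ⟨hs, hx⟩
  dsimp only at hs hx
  refine continuousWithinAt_pi.2 fun i ↦ ?_
  have hπ : ∀ l, ContinuousAt (fun p : ℝ × (Fin n → X) ↦ p.2 l) (s, x) := fun l ↦ by fun_prop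
  rcases mem_vertexSet_or (x i) with hv | ⟨e, he⟩
  · rw [ContinuousWithinAt, flow_of_mem_vertexSet (x := x) hv]
    refine Filter.tendsto_def.2 fun U hU ↦ ?_
    have h1 : ∀ᶠ y in 𝓝 (x i), ∀ e, y ∈ RelCWComplex.openCell (C := univ) 1 e →
        ∀ u, EndControlled (n + 1) (coord e y) u → edgeMap e u ∈ U :=
      Filter.eventually_all.2 fun e ↦
        eventually_edgeMap_mem _ hU (notMem_openCell_of_mem_vertexSet hv)
    filter_upwards [((hπ i).eventually h1).filter_mono nhdsWithin_le_nhds,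
      ((hπ i).eventually hU).filter_mono nhdsWithin_le_nhds, self_mem_nhdsWithin] with p h2 h3 h4
    rcases mem_vertexSet_or (p.2 i) with hv' | ⟨e, he⟩
    · rw [mem_preimage, flow_of_mem_vertexSet hv']
      exact h3
    · rw [mem_preimage, flow_of_mem he]
      exact h2 e he _ (endControlled_flowCoord h4.1 (coord_mem he) _)
  · apply ContinuousAt.continuousWithinAt
    have hmem : ∀ᶠ p : ℝ × (Fin n → X) in 𝓝 (s, x),
        p.2 i ∈ RelCWComplex.openCell (C := univ) 1 e :=
      (hπ i).eventually ((isOpen_edge e).mem_nhds he)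
    have hc : ContinuousAt (fun p : ℝ × (Fin n → X) ↦ coord e (p.2 i)) (s, x) :=
      ContinuousAt.comp' (f := fun p : ℝ × (Fin n → X) ↦ p.2 i) (continuousAt_coord he) (hπ i)
    have hpush : ∀ l, ContinuousAt
        (fun p : ℝ × (Fin n → X) ↦ push e (coord e (p.2 i)) (p.2 l)) (s, x) := by
      intro l
      by_cases hl : i = l
      · subst hl
        -- A point sits on its own jump locus, where `continuousAt_push` does not apply, but its
        -- push on itself is identically zero.
        refine (continuousAt_const (y := (0 : ℝ))).congr ?_
        filter_upwards [hmem] with p hp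
        rw [push_of_mem hp, pushCoord_self]
      · have hne : x l ≠ edgeMap e (coord e (x i)) := by
          rw [edgeMap_coord he]
          intro h
          exact coord_ne hx hl he (h ▸ he) (by rw [h])
        exact ContinuousAt.comp' (f := fun p : ℝ × (Fin n → X) ↦ (coord e (p.2 i), p.2 l))
          (g := fun q : ℝ × X ↦ push e q.1 q.2) (continuousAt_push (coord_mem he) hne)
          (hc.prodMk (hπ l))
    have hF : ContinuousAt
        (fun p : ℝ × (Fin n → X) ↦ flowCoord e p.1 p.2 (coord e (p.2 i))) (s, x) := by
      refine ((continuousAt_const.sub continuousAt_fst).mul hc).add (continuousAt_fst.mul ?_)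
      refine continuous_clamp.continuousAt.comp' (hc.add ?_)
      exact tendsto_finsetSum _ fun l _ ↦ hpush l
    refine ((continuous_edgeMap e).continuousAt.comp' hF).congr ?_
    filter_upwards [hmem] with p hp
    rw [flow_of_mem hp]

theorem exists_homotopyEquiv_inclusion (X : Type*) [TopologicalSpace X]
    [CWComplex (univ : Set X)] [IsGraph X] (n : ℕ) :
    ∃ h : ContinuousMap.HomotopyEquiv (discreteSinkConf n X : Set (Fin n → X)) (sinkConf n X),
      ∀ x, (h x : Fin n → X) = x := by
  have hflow : Continuous fun p : unitInterval × sinkConf n X ↦ flow (p.1 : ℝ) p.2.1 :=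
    continuousOn_flow.comp_continuous
      ((continuous_subtype_val.comp continuous_fst).prodMk
        (continuous_subtype_val.comp continuous_snd)) fun p ↦ ⟨p.1.2, p.2.2⟩
  let F : C(unitInterval × sinkConf n X, sinkConf n X) :=
    ⟨fun p ↦ ⟨flow p.1 p.2, flow_mem_sinkConf p.1.2 p.2.2⟩, hflow.subtype_mk _⟩
  let ι : C((discreteSinkConf n X : Set (Fin n → X)), sinkConf n X) :=
    ⟨inclusion discreteSinkConf_subset, continuous_inclusion _⟩
  let r : C(sinkConf n X, (discreteSinkConf n X : Set (Fin n → X))) :=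
    ⟨fun x ↦ ⟨flow 1 x.1, flow_one_mem x.2⟩, Continuous.subtype_mk
      (hflow.comp (Continuous.prodMk_right (1 : unitInterval))) _⟩
  have hri : r.comp ι = ContinuousMap.id _ := by
    ext1 x
    exact Subtype.ext (flow_of_mem_discreteSinkConf 1 x.2)
  refine ⟨⟨ι, r, hri ▸ .refl _, ContinuousMap.Homotopic.symm ⟨⟨F, fun x ↦ ?_, fun x ↦ ?_⟩⟩⟩,
    fun x ↦ rfl⟩
  · exact Subtype.ext (flow_zero x.1)
  · rfl

end

/-! ### Dimension bound -/

section

variable {X : Type*} [TopologicalSpace X] [CWComplex (univ : Set X)] {n : ℕ}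
  {e : RelCWComplex.cell (univ : Set X) 1}

theorem sum_dim_le_card_edge [IsGraph X] {σ : Fin n → Cell X} (hσ : Admissible σ) :
    ∑ i, (σ i).1 ≤ Nat.card (RelCWComplex.cell (univ : Set X) 1) := by
  classical
  have h1 : ∑ i, (σ i).1 = Fintype.card {i // (σ i).1 = 1} := by
    rw [Fintype.card_subtype, Finset.card_filter]
    refine Finset.sum_congr rfl fun i _ ↦ ?_
    have := cell_dim_le_one (σ i)
    split_ifs <;> omega
  rw [h1, ← Nat.card_eq_fintype_card]
  have hedge : ∀ i : {i // (σ i).1 = 1}, ∃ e, σ i = ⟨1, e⟩ := by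
    rintro ⟨i, hi⟩
    dsimp only
    generalize σ i = c at hi
    obtain ⟨k, c⟩ := c
    obtain rfl : k = 1 := hi
    exact ⟨c, rfl⟩
  choose g hg using hedge
  refine Nat.card_le_card_of_injective g fun i j hij ↦ ?_
  by_contra hne
  exact hσ i j (fun h ↦ hne (Subtype.ext h)) i.2 j.2 (by rw [hg, hg, hij])

/-! ### Trees: unwinding around an edge -/

theorem exists_lift_of_contractible {Y : Type*} [TopologicalSpace Y] [ContractibleSpace Y] (p : ℝ) (g : C(Y, AddCircle p)) :
    ∃ θ : C(Y, ℝ), ∀ x, (θ x : AddCircle p) = g x := by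
  obtain ⟨x₀, ⟨H⟩⟩ := id_nullhomotopic Y
  obtain ⟨r, hr⟩ := QuotientAddGroup.mk_surjective (g x₀)
  -- Run the contraction backwards: the homotopy starts at a constant map, which lifts, and the
  -- lifted homotopy ends at a lift of `g`.
  let G : C(unitInterval × Y, AddCircle p) := g.comp (H.symm : C(unitInterval × Y, Y))
  have hG : ∀ a, G (0, a) = ((ContinuousMap.const Y r a : ℝ) : AddCircle p) := fun a ↦ by
    simpa [G] using hr.symm
  have cov := AddCircle.isCoveringMap_coe p
  refine ⟨(cov.liftHomotopy G (.const Y r) hG).comp ⟨fun x ↦ (1, x), by fun_prop⟩, fun x ↦ ?_⟩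
  have := congrFun (cov.liftHomotopy_lifts G (.const Y r) hG) (1, x)
  simpa [G] using this

open Classical in
/-- The map from the graph to the circle that goes around once on the edge `e` and is constant
outside it. -/
noncomputable def collapse (e : RelCWComplex.cell (univ : Set X) 1) (x : X) : AddCircle (2 : ℝ) :=
  if x ∈ RelCWComplex.openCell (C := univ) 1 e then (coord e x : AddCircle (2 : ℝ))
  else ((1 : ℝ) : AddCircle (2 : ℝ))

theorem collapse_of_notMem {x : X} (hx : x ∉ RelCWComplex.openCell (C := univ) 1 e) :
    collapse e x = ((1 : ℝ) : AddCircle (2 : ℝ)) := if_neg hx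

theorem coe_neg_one_eq : (((-1 : ℝ)) : AddCircle (2 : ℝ)) = ((1 : ℝ) : AddCircle (2 : ℝ)) := by
  rw [← AddCircle.coe_add_period]
  norm_num

theorem collapse_edgeMap {t : ℝ} (ht : t ∈ Icc (-1 : ℝ) 1) :
    collapse e (edgeMap e t) = (t : AddCircle (2 : ℝ)) := by
  by_cases h : edgeMap e t ∈ RelCWComplex.openCell (C := univ) 1 e
  · rw [collapse, if_pos h, coord_edgeMap e (mem_openCell_of_edgeMap_mem ht h).2]
  · rw [collapse_of_notMem h]
    rcases eq_or_eq_of_edgeMap_notMem ht h with rfl | rfl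
    · exact coe_neg_one_eq.symm
    · rfl

theorem continuous_collapse [IsGraph X] : Continuous (collapse e) := by
  refine continuous_iff_isClosed.2 fun C hC ↦ ?_
  have hcoe : Continuous ((↑) : ℝ → AddCircle (2 : ℝ)) := AddCircle.continuous_mk' 2
  have hK : IsClosed (edgeMap e '' (Icc (-1) 1 ∩ (↑) ⁻¹' C)) :=
    ((isCompact_Icc.inter_right (hC.preimage hcoe)).image (continuous_edgeMap e)).isClosed
  have key : collapse e ⁻¹' C = edgeMap e '' (Icc (-1) 1 ∩ (↑) ⁻¹' C) ∪
      {x | x ∉ RelCWComplex.openCell (C := univ) 1 e ∧ ((1 : ℝ) : AddCircle (2 : ℝ)) ∈ C} := by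
    ext x
    constructor
    · intro hx
      by_cases h : x ∈ RelCWComplex.openCell (C := univ) 1 e
      · refine .inl ⟨coord e x, ⟨Ioo_subset_Icc_self (coord_mem h), ?_⟩, edgeMap_coord h⟩
        rwa [mem_preimage, collapse, if_pos h] at hx
      · exact .inr ⟨h, by rwa [mem_preimage, collapse_of_notMem h] at hx⟩
    · rintro (⟨t, ⟨ht, htC⟩, rfl⟩ | ⟨h, h1⟩)
      · rw [mem_preimage, collapse_edgeMap ht]
        exact htC
      · rw [mem_preimage, collapse_of_notMem h]
        exact h1
  rw [key]
  refine hK.union ?_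
  by_cases h1 : ((1 : ℝ) : AddCircle (2 : ℝ)) ∈ C
  · simp only [h1, and_true]
    exact (isOpen_edge e).isClosed_compl
  · simp [h1]

variable (e) in
theorem exists_unwinding [IsGraph X] [ContractibleSpace X] :
    ∃ θ : X → ℝ, θ (edgeMap e 1) = θ (edgeMap e (-1)) + 2 ∧
      ∀ f, f ≠ e → ∀ s ∈ Icc (-1 : ℝ) 1, θ (edgeMap f s) = θ (edgeMap f (-1)) := by
  obtain ⟨θ, hθ⟩ := exists_lift_of_contractible 2 ⟨collapse e, continuous_collapse⟩
  have cov := AddCircle.isCoveringMap_coe (2 : ℝ)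
  have h0 : (-1 : ℝ) ∈ Icc (-1 : ℝ) 1 := by norm_num
  have h1 : (1 : ℝ) ∈ Icc (-1 : ℝ) 1 := by norm_num
  refine ⟨θ, ?_, fun f hf s hs ↦ ?_⟩
  · have := cov.eqOn_of_comp_eqOn (isPreconnected_Icc (a := (-1 : ℝ)) (b := 1))
      (g₁ := fun t ↦ θ (edgeMap e t)) (g₂ := fun t ↦ t + (θ (edgeMap e (-1)) + 1))
      (θ.continuous.comp (continuous_edgeMap e)).continuousOn (by fun_prop) (fun t ht ↦ ?_)
      h0 (by ring) h1
    · dsimp only at this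
      linarith
    · have h2 : (1 : ℝ) + 1 = 2 := by norm_num
      simp only [Function.comp_apply, AddCircle.coe_add, hθ, ContinuousMap.coe_mk,
        collapse_edgeMap ht, collapse_edgeMap h0, coe_neg_one_eq]
      rw [← AddCircle.coe_add 2 1 1, h2, AddCircle.coe_period, add_zero]
  · refine cov.eqOn_of_comp_eqOn (isPreconnected_Icc (a := (-1 : ℝ)) (b := 1))
      (g₁ := fun t ↦ θ (edgeMap f t)) (g₂ := fun t ↦ θ (edgeMap f (-1)))
      (θ.continuous.comp (continuous_edgeMap f)).continuousOn (by fun_prop) (fun t ht ↦ ?_)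
      h0 rfl hs
    have hout : ∀ t ∈ Icc (-1 : ℝ) 1, edgeMap f t ∉ RelCWComplex.openCell (C := univ) 1 e :=
      fun t ht h ↦ hf (mem_openCell_of_edgeMap_mem ht h).1
    simp only [Function.comp_apply, hθ, ContinuousMap.coe_mk, collapse_of_notMem (hout t ht),
      collapse_of_notMem (hout _ h0)]

theorem edgeMap_one_ne [IsGraph X] [ContractibleSpace X] : edgeMap e 1 ≠ edgeMap e (-1) := by
  intro h
  obtain ⟨θ, hθ, -⟩ := exists_unwinding e
  rw [h] at hθ
  linarith

theorem injOn_edgeMap [IsGraph X] [ContractibleSpace X] :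
    InjOn (edgeMap e) (Icc (-1 : ℝ) 1) := by
  intro s hs t ht hst
  by_cases h : edgeMap e s ∈ RelCWComplex.openCell (C := univ) 1 e
  · rw [← coord_edgeMap e (mem_openCell_of_edgeMap_mem hs h).2, hst,
      coord_edgeMap e (mem_openCell_of_edgeMap_mem ht (hst ▸ h)).2]
  · rcases eq_or_eq_of_edgeMap_notMem hs h with rfl | rfl <;>
      rcases eq_or_eq_of_edgeMap_notMem ht (hst ▸ h) with rfl | rfl
    · rfl
    · exact (edgeMap_one_ne hst.symm).elim
    · exact (edgeMap_one_ne hst).elim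
    · rfl

/-- The unwinding function of `e` is constant on `f` but separates the two ends of `e`, so `f`
cannot contain both. -/
theorem eq_of_edgeMap_eq_of_ne [IsGraph X] [ContractibleSpace X]
    {f : RelCWComplex.cell (univ : Set X) 1} (hef : e ≠ f) {s s' t t' : ℝ}
    (hs : s = -1 ∨ s = 1) (hs' : s' = -1 ∨ s' = 1) (ht : t ∈ Icc (-1 : ℝ) 1)
    (ht' : t' ∈ Icc (-1 : ℝ) 1) (h : edgeMap e s = edgeMap f t)
    (h' : edgeMap e s' = edgeMap f t') : s = s' := by
  obtain ⟨θ, hθ, hf⟩ := exists_unwinding e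
  have hθ' : θ (edgeMap e s) = θ (edgeMap e s') := by
    rw [h, h', hf f hef.symm t ht, hf f hef.symm t' ht']
  rcases hs with rfl | rfl <;> rcases hs' with rfl | rfl <;> first | rfl | linarith

theorem injOn_map [IsGraph X] [ContractibleSpace X] (c : Cell X) :
    InjOn (RelCWComplex.map (C := univ) c.1 c.2) (closedBall 0 1) := by
  obtain ⟨k, c⟩ := c
  have hk : k ≤ 1 := cell_dim_le_one ⟨k, c⟩
  interval_cases k
  · exact fun x _ y _ _ ↦ Subsingleton.elim (α := Fin 0 → ℝ) x y
  · intro x hx y hy hxy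
    dsimp only at hx hy hxy
    rw [map_one_eq_edgeMap c hx, map_one_eq_edgeMap c hy] at hxy
    have := injOn_edgeMap (mem_closedBall_one.1 hx) (mem_closedBall_one.1 hy) hxy
    funext i
    rw [Subsingleton.elim i 0, this]

theorem map_mem_vertexSet_or [IsGraph X] (c : Cell X) {x : Fin c.1 → ℝ}
    (hx : x ∈ closedBall 0 1) :
    (RelCWComplex.map (C := univ) c.1 c.2 x ∈ vertexSet X ∧ ∀ i, x i = -1 ∨ x i = 1) ∨
      RelCWComplex.map (C := univ) c.1 c.2 x ∈ RelCWComplex.openCell (C := univ) c.1 c.2 ∧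
        c.1 = 1 := by
  obtain ⟨k, c⟩ := c
  have hk : k ≤ 1 := cell_dim_le_one ⟨k, c⟩
  interval_cases k
  · exact .inl ⟨mem_iUnion.2 ⟨c, x, hx, rfl⟩, fun i ↦ i.elim0⟩
  · dsimp only at hx ⊢
    rw [map_one_eq_edgeMap c hx]
    by_cases h : edgeMap c (x 0) ∈ RelCWComplex.openCell (C := univ) 1 c
    · exact .inr ⟨h, rfl⟩
    · have h0 := eq_or_eq_of_edgeMap_notMem (mem_closedBall_one.1 hx) h
      refine .inl ⟨edgeMap_mem_vertexSet h0, fun i ↦ ?_⟩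
      rwa [Subsingleton.elim i 0]

/-- Open cells are disjoint and edge interiors contain no vertex, so a common point of distinct
closed cells is a vertex in both. -/
theorem forall_eq_of_map_eq [IsGraph X] {c d : Cell X} (hcd : c ≠ d) {x : Fin c.1 → ℝ}
    {y : Fin d.1 → ℝ} (hx : x ∈ closedBall 0 1) (hy : y ∈ closedBall 0 1)
    (h : RelCWComplex.map (C := univ) c.1 c.2 x = RelCWComplex.map (C := univ) d.1 d.2 y) :
    (∀ i, x i = -1 ∨ x i = 1) ∧ ∀ i, y i = -1 ∨ y i = 1 := by
  rcases map_mem_vertexSet_or c hx with ⟨h1, h2⟩ | ⟨h1, h2⟩ <;>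
    rcases map_mem_vertexSet_or d hy with ⟨h3, h4⟩ | ⟨h3, h4⟩
  · exact ⟨h2, h4⟩
  · obtain ⟨k, d⟩ := d
    obtain rfl : k = 1 := h4
    exact (notMem_openCell_of_mem_vertexSet h1 (h ▸ h3)).elim
  · obtain ⟨k, c⟩ := c
    obtain rfl : k = 1 := h2
    exact (notMem_openCell_of_mem_vertexSet h3 (h ▸ h1)).elim
  · exact (hcd (eq_of_mem_openCell h1 (h ▸ h3))).elim

theorem eq_of_map_eq_of_ne [IsGraph X] [ContractibleSpace X] {c d : Cell X} (hcd : c ≠ d)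
    {x a : Fin c.1 → ℝ} {y b : Fin d.1 → ℝ} (hx : x ∈ closedBall 0 1) (ha : a ∈ closedBall 0 1)
    (hy : y ∈ closedBall 0 1) (hb : b ∈ closedBall 0 1)
    (h : RelCWComplex.map (C := univ) c.1 c.2 x = RelCWComplex.map (C := univ) d.1 d.2 y)
    (h' : RelCWComplex.map (C := univ) c.1 c.2 a = RelCWComplex.map (C := univ) d.1 d.2 b) :
    x = a ∧ y = b := by
  suffices hor : x = a ∨ y = b by
    rcases hor with rfl | rfl
    · exact ⟨rfl, injOn_map d hy hb (h.symm.trans h')⟩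
    · exact ⟨injOn_map c hx ha (h.trans h'.symm), rfl⟩
  have hxy := forall_eq_of_map_eq hcd hx hy h
  have hab := forall_eq_of_map_eq hcd ha hb h'
  obtain ⟨k, c⟩ := c
  obtain ⟨l, d⟩ := d
  have hk : k ≤ 1 := cell_dim_le_one ⟨k, c⟩
  have hl : l ≤ 1 := cell_dim_le_one ⟨l, d⟩
  interval_cases k
  · exact .inl (Subsingleton.elim (α := Fin 0 → ℝ) _ _)
  · interval_cases l
    · exact .inr (Subsingleton.elim (α := Fin 0 → ℝ) _ _)
    · left
      dsimp only at x a y b hx ha hy hb h h' hxy hab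
      rw [map_one_eq_edgeMap c hx, map_one_eq_edgeMap d hy] at h
      rw [map_one_eq_edgeMap c ha, map_one_eq_edgeMap d hb] at h'
      have := eq_of_edgeMap_eq_of_ne (fun hne ↦ hcd (congrArg (Sigma.mk 1) hne)) (hxy.1 0) (hab.1 0)
        (mem_closedBall_one.1 hy) (mem_closedBall_one.1 hb) h h'
      funext i
      rw [Subsingleton.elim i 0, this]

/-! ### Gluing cubes along faces -/

/-- Two maps defined on cubes are glued along a face: they identify a face of the one cube with a
face of the other by an isometry, and nothing else. -/
def FaceGluing {Y : Type*} {k l : ℕ} (φ : (Fin k → ℝ) → Y) (ψ : (Fin l → ℝ) → Y) : Prop :=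
  ∃ (T : Set (Fin k → ℝ)) (T' : Set (Fin l → ℝ)) (f : (Fin k → ℝ) → (Fin l → ℝ)),
    IsCubeFace T ∧ IsCubeFace T' ∧ BijOn f T T' ∧
    (∀ x ∈ T, ∀ y ∈ T, ∑ j, (f x j - f y j) ^ 2 = ∑ j, (x j - y j) ^ 2) ∧
    ∀ x ∈ closedBall (0 : Fin k → ℝ) 1, ∀ y ∈ closedBall (0 : Fin l → ℝ) 1,
      φ x = ψ y ↔ x ∈ T ∧ y = f x

theorem isCubeFace_closedBall (k : ℕ) : IsCubeFace (closedBall (0 : Fin k → ℝ) 1) := by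
  refine ⟨fun _ ↦ Icc (-1) 1, fun _ ↦ .inr (.inr rfl), ?_⟩
  ext x
  rw [mem_closedBall_zero_iff, pi_norm_le_iff_of_nonneg zero_le_one]
  simp only [Real.norm_eq_abs, abs_le, mem_univ_pi, mem_Icc]

theorem isCubeFace_singleton {k : ℕ} {a : Fin k → ℝ} (ha : ∀ i, a i = -1 ∨ a i = 1) :
    IsCubeFace {a} := by
  refine ⟨fun i ↦ {a i}, fun i ↦ ?_, (univ_pi_singleton a).symm⟩
  rcases ha i with h | h <;> simp [h]

/-- Equal cells are glued along the whole cube by the identity, distinct ones along their unique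
common vertex. -/
theorem faceGluing_map [IsGraph X] [ContractibleSpace X] (c d : Cell X)
    (h : (RelCWComplex.closedCell (C := univ) c.1 c.2 ∩
      RelCWComplex.closedCell (C := univ) d.1 d.2).Nonempty) :
    FaceGluing (RelCWComplex.map (C := univ) c.1 c.2) (RelCWComplex.map (C := univ) d.1 d.2) := by
  by_cases hcd : c = d
  · subst hcd
    refine ⟨_, _, id, isCubeFace_closedBall _, isCubeFace_closedBall _, bijOn_id _,
      fun x _ y _ ↦ rfl, fun x hx y hy ↦ ⟨fun hxy ↦ ⟨hx, (injOn_map c hx hy hxy).symm⟩, ?_⟩⟩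
    rintro ⟨-, rfl⟩
    rfl
  · obtain ⟨_, ⟨a, ha, rfl⟩, b, hb, hab⟩ := h
    obtain ⟨ha', hb'⟩ := forall_eq_of_map_eq hcd ha hb hab.symm
    refine ⟨{a}, {b}, fun _ ↦ b, isCubeFace_singleton ha', isCubeFace_singleton hb',
      bijOn_singleton.2 rfl, ?_, fun x hx y hy ↦
        ⟨fun hxy ↦ eq_of_map_eq_of_ne hcd hx ha hy hb hxy hab.symm, ?_⟩⟩
    · rintro x rfl y rfl
      simp
    · rintro ⟨rfl, rfl⟩
      exact hab.symm

/-- The coordinates of a product of cubes, indexed by the factors and their coordinates. -/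
def blockEquiv (σ : Fin n → Cell X) {k : ℕ} (h : ∑ i, (σ i).1 = k) :
    (i : Fin n) × Fin (σ i).1 ≃ Fin k :=
  finSigmaFinEquiv.trans (finCongr h)

theorem isCubeFace_blocks (σ : Fin n → Cell X) {k : ℕ} (h : ∑ i, (σ i).1 = k)
    {T : ∀ i, Set (Fin (σ i).1 → ℝ)} (hT : ∀ i, IsCubeFace (T i)) :
    IsCubeFace {y | ∀ i, block σ h y i ∈ T i} := by
  choose F hF hTF using hT
  refine ⟨fun j ↦ F ((blockEquiv σ h).symm j).1 ((blockEquiv σ h).symm j).2, fun j ↦ hF _ _, ?_⟩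
  ext y
  simp only [mem_ofPred_eq, hTF, mem_univ_pi]
  rw [← (blockEquiv σ h).forall_congr_right, Sigma.forall]
  refine forall_congr' fun i ↦ forall_congr' fun j ↦ ?_
  rw [Equiv.symm_apply_apply]
  rfl

theorem sum_eq_sum_block (σ : Fin n → Cell X) {k : ℕ} (h : ∑ i, (σ i).1 = k)
    (x y : Fin k → ℝ) :
    ∑ j, (x j - y j) ^ 2 = ∑ i, ∑ j, (block σ h x i j - block σ h y i j) ^ 2 := by
  rw [← (blockEquiv σ h).sum_comp, Fintype.sum_sigma]
  rfl

/-- Everything splits over the factors: products of faces are faces, squared Euclidean distances add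
up, and points of `X ^ n` are compared coordinatewise. -/
theorem faceGluing_productMap {σ τ : Fin n → Cell X} {k l : ℕ} (h : ∑ i, (σ i).1 = k)
    (h' : ∑ i, (τ i).1 = l)
    (H : ∀ i, FaceGluing (RelCWComplex.map (C := univ) (σ i).1 (σ i).2)
      (RelCWComplex.map (C := univ) (τ i).1 (τ i).2)) :
    FaceGluing (productMap σ h) (productMap τ h') := by
  choose T T' f hT hT' hf hdist hglue using H
  refine ⟨{x | ∀ i, block σ h x i ∈ T i}, {y | ∀ i, block τ h' y i ∈ T' i},
    fun x ↦ unblock τ h' fun i ↦ f i (block σ h x i), isCubeFace_blocks σ h hT,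
    isCubeFace_blocks τ h' hT', ⟨fun x hx i ↦ ?_, fun x hx y hy hxy ↦ ?_, fun y hy ↦ ?_⟩,
    fun x hx y hy ↦ ?_, fun x hx y hy ↦ ?_⟩
  · rw [block_unblock]
    exact (hf i).mapsTo (hx i)
  · have hb := congrArg (block τ h') hxy
    simp only [block_unblock] at hb
    rw [← unblock_block σ h x, ← unblock_block σ h y]
    congr 1
    funext i
    exact (hf i).injOn (hx i) (hy i) (congrFun hb i)
  · choose z hz hzy using fun i ↦ (hf i).surjOn (hy i)
    refine ⟨unblock σ h z, fun i ↦ ?_, ?_⟩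
    · rw [block_unblock]
      exact hz i
    · simp only [block_unblock, hzy]
      exact unblock_block τ h' y
  · rw [sum_eq_sum_block σ h, sum_eq_sum_block τ h']
    refine Finset.sum_congr rfl fun i _ ↦ ?_
    simp only [block_unblock]
    exact hdist i _ (hx i) _ (hy i)
  · have hx' := (mem_closedBall_block σ h x).1 hx
    have hy' := (mem_closedBall_block τ h' y).1 hy
    have h1 : productMap σ h x = productMap τ h' y ↔
        ∀ i, block σ h x i ∈ T i ∧ block τ h' y i = f i (block σ h x i) :=
      funext_iff.trans (forall_congr' fun i ↦ hglue i _ (hx' i) _ (hy' i))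
    rw [h1, forall_and]
    refine and_congr_right fun _ ↦ ⟨fun hall ↦ ?_, ?_⟩
    · rw [← unblock_block τ h' y]
      congr 1
      funext i
      exact hall i
    · rintro rfl i
      rw [block_unblock]

theorem injOn_productMap [IsGraph X] [ContractibleSpace X] (σ : Fin n → Cell X) {k : ℕ}
    (h : ∑ i, (σ i).1 = k) : InjOn (productMap σ h) (closedBall 0 1) := by
  intro x hx y hy hxy
  rw [← unblock_block σ h x, ← unblock_block σ h y]
  congr 1
  funext i
  exact injOn_map (σ i) ((mem_closedBall_block σ h x).1 hx i)
    ((mem_closedBall_block σ h y).1 hy i) (congrFun hxy i)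

theorem isCubical_discreteSinkConf [IsGraph X] [ContractibleSpace X] :
    IsCubical (discreteSinkConf n X : Set (Fin n → X)) := by
  refine ⟨fun k c ↦ injOn_productMap c.1.1 c.1.2, fun k l c d hcd ↦ ?_⟩
  obtain ⟨⟨σ, h⟩, hσ⟩ := c
  obtain ⟨⟨τ, h'⟩, hτ⟩ := d
  have hmeet : (productMap σ h '' closedBall 0 1 ∩ productMap τ h' '' closedBall 0 1).Nonempty :=
    hcd
  rw [productMap_image_closedBall, productMap_image_closedBall] at hmeet
  obtain ⟨z, hz, hz'⟩ := hmeet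
  -- The coordinates of the common point `z` show that the closed cells meet in every factor.
  obtain ⟨T, T', f, hT, hT', hf, hdist, hglue⟩ := faceGluing_productMap h h' fun i ↦
    faceGluing_map (σ i) (τ i) ⟨z i, hz i, hz' i⟩
  refine ⟨T, T', f, hT, hT', hf, fun x hx y hy ↦ ?_, hglue⟩
  simp only [EuclideanSpace.dist_eq, Real.dist_eq, sq_abs]
  rw [hdist x hx y hy]

end

end SinkConf

theorem theoremA (X : Type*) [TopologicalSpace X] [CWComplex (univ : Set X)] [SinkConf.IsGraph X]
    (n : ℕ) :
    -- the inclusion of the discrete model is a homotopy equivalence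
    (∃ h : ContinuousMap.HomotopyEquiv (SinkConf.discreteSinkConf n X : Set (Fin n → X))
        (SinkConf.sinkConf n X),
      ∀ x, (h x : Fin n → X) = x) ∧
    -- the discrete model has no cells of dimension greater than the number of edges
    (∀ k : ℕ, Nat.card (RelCWComplex.cell (univ : Set X) 1) < k →
      IsEmpty (RelCWComplex.cell (SinkConf.discreteSinkConf n X : Set (Fin n → X)) k)) ∧
    -- for a tree, the discrete model is a cubical complex
    (ContractibleSpace X → SinkConf.IsCubical (SinkConf.discreteSinkConf n X : Set (Fin n → X))) := by
  refine ⟨SinkConf.exists_homotopyEquiv_inclusion X n, fun k hk ↦ ⟨?_⟩,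
    fun _ ↦ SinkConf.isCubical_discreteSinkConf⟩
  rintro ⟨⟨σ, h⟩, hσ⟩
  exact (hk.trans_le (h ▸ SinkConf.sum_dim_le_card_edge hσ)).false
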